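/- Let $(X_t)_{t\in T}$ be jointly Gaussian real random variables on a probability space with $EX_t=0$ for all $t\in T$. Let $\mathcal H_1\subset L^2$ be the closure of the set of finite linear combinations $\sum_j c_jX_{t_j}$. For $n\ge 0$ let $\mathcal H_{\le n}\subset L^2$ be the closure of the set of all polynomials of degree at most $n$ in finitely many of the variables $X_t$, and put $\mathcal H_0=\mathcal H_{\le 0}$ and $\mathcal H_n=\mathcal H_{\le n}\ominus\mathcal H_{\le n-1}$ for $n\ge1$. For a homogeneous real polynomial $P(x_1,\dots,x_m)$ of degree $n$ and $\xi_1,\dots,\xi_m\in\mathcal H_1$, the Wick polynomial $:\!P(\xi_1,\dots,\xi_m)\!:$ is the orthogonal projection of the (square integrable) random variable $P(\xi_1,\dots,\xi_m)$ to $\mathcal H_n$. Let $n\ge1$ and $U_1,\dots,U_{n+1}\in\mathcal H_1$. Then, almost surely, $$:\!U_1\cdots U_n\!:\;U_{n+1}\;=\;:\!U_1\cdots U_{n+1}\!:\;+\;\sum_{s=1}^n :\!U_1\cdots U_{s-1}U_{s+1}\cdots U_n\!:\;E\,U_sU_{n+1}.$$ In the special case $n=1$ this means $U_1U_2=\;:\!U_1U_2\!:+\,E\,U_1U_2$.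 -/

import Mathlib

open MeasureTheory ProbabilityTheory
open scoped ENNReal

noncomputable section

namespace WickChaos

variable {Ω T : Type*} [MeasurableSpace Ω]

/-- The first chaos `H₁`: the closure in `L²(P)` of the space of finite linear combinations
`∑ c_j X_{t_j}`. -/
def firstChaos (X : T → Ω → ℝ) (P : Measure Ω) : Submodule ℝ (Lp ℝ 2 P) :=
  (Submodule.span ℝ {f : Lp ℝ 2 P | ∃ t : T, f =ᵐ[P] X t}).topologicalClosure

/-- The random variables `Q(X_{t_1}, …, X_{t_m})` in `L²(P)`, where `Q` is a real polynomial of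
degree at most `n` (in arbitrarily, but finitely, many of the variables `X_t`). -/
def polySpace (X : T → Ω → ℝ) (P : Measure Ω) (n : ℕ) : Submodule ℝ (Lp ℝ 2 P) where
  carrier := {f | ∃ q : MvPolynomial T ℝ, q.totalDegree ≤ n ∧
    f =ᵐ[P] fun ω => MvPolynomial.eval (fun t => X t ω) q}
  add_mem' := by
    rintro f g ⟨p, hp, hf⟩ ⟨q, hq, hg⟩
    refine ⟨p + q, (MvPolynomial.totalDegree_add p q).trans (max_le hp hq), ?_⟩
    filter_upwards [Lp.coeFn_add f g, hf, hg] with ω h1 h2 h3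
    rw [h1, Pi.add_apply, h2, h3, map_add]
  zero_mem' := ⟨0, by simp, by
    filter_upwards [Lp.coeFn_zero ℝ 2 P] with ω h
    rw [h, Pi.zero_apply, map_zero]⟩
  smul_mem' := by
    rintro c f ⟨p, hp, hf⟩
    refine ⟨c • p, (MvPolynomial.totalDegree_smul_le c p).trans hp, ?_⟩
    filter_upwards [Lp.coeFn_smul c f, hf] with ω h1 h2
    simp [h1, h2]

/-- `H_{≤ n}`: the closure of the polynomials of degree at most `n` in the variables `X_t`.
It consists of (classes of) functions measurable with respect to the `σ`-algebra generated by
the `X_t`, so that it does not matter whether the closure is taken in `L²(P)` or in its closed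
subspace of such functions. -/
def chaosLE (X : T → Ω → ℝ) (P : Measure Ω) (n : ℕ) : Submodule ℝ (Lp ℝ 2 P) :=
  (polySpace X P n).topologicalClosure

/-- The `n`-th chaos: `H₀ = H_{≤ 0}` and `H_n = H_{≤ n} ⊖ H_{≤ n-1}` for `n ≥ 1`. -/
def chaos (X : T → Ω → ℝ) (P : Measure Ω) : ℕ → Submodule ℝ (Lp ℝ 2 P)
  | 0 => chaosLE X P 0
  | n + 1 => chaosLE X P (n + 1) ⊓ (chaosLE X P n)ᗮ

theorem isClosed_chaos (X : T → Ω → ℝ) (P : Measure Ω) (n : ℕ) :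
    IsClosed (chaos X P n : Set (Lp ℝ 2 P)) := by
  cases n with
  | zero => exact Submodule.isClosed_topologicalClosure _
  | succ n =>
    exact (Submodule.isClosed_topologicalClosure _).inter (Submodule.isClosed_orthogonal _)

instance completeSpace_chaos (X : T → Ω → ℝ) (P : Measure Ω) (n : ℕ) :
    CompleteSpace (chaos X P n) :=
  (isClosed_chaos X P n).completeSpace_coe

variable {X : T → Ω → ℝ} {P : Measure Ω}

theorem hasGaussianLaw_of_mem_span (hX : IsGaussianProcess X P) {f : Lp ℝ 2 P}
    (hf : f ∈ Submodule.span ℝ {f : Lp ℝ 2 P | ∃ t : T, f =ᵐ[P] X t}) :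
    HasGaussianLaw f P := by
  classical
  have key : ∃ c : T →₀ ℝ, f =ᵐ[P] fun ω => c.sum fun t a => a * X t ω := by
    induction hf using Submodule.span_induction with
    | mem f hf =>
      obtain ⟨t, ht⟩ := hf
      refine ⟨Finsupp.single t 1, ?_⟩
      filter_upwards [ht] with ω h
      simp [h]
    | zero =>
      refine ⟨0, ?_⟩
      filter_upwards [Lp.coeFn_zero ℝ 2 P] with ω h
      rw [h, Pi.zero_apply, Finsupp.sum_zero_index]
    | add f g _ _ hf hg =>
      obtain ⟨c, hc⟩ := hf
      obtain ⟨d, hd⟩ := hg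
      refine ⟨c + d, ?_⟩
      filter_upwards [Lp.coeFn_add f g, hc, hd] with ω h1 h2 h3
      rw [h1, Pi.add_apply, h2, h3, Finsupp.sum_add_index' (by simp) (by intros; ring)]
    | smul a f _ hf =>
      obtain ⟨c, hc⟩ := hf
      refine ⟨a • c, ?_⟩
      filter_upwards [Lp.coeFn_smul a f, hc] with ω h1 h2
      rw [h1, Pi.smul_apply, h2, Finsupp.sum_smul_index (by simp), smul_eq_mul, Finsupp.mul_sum]
      simp only [mul_assoc]
  obtain ⟨c, hc⟩ := key
  refine HasGaussianLaw.congr ?_ hc.symm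
  simpa [Finsupp.sum] using (hX.smul c).hasGaussianLaw_fun_sum (I := c.support)

theorem hasGaussianLaw_of_mem_firstChaos (hX : IsGaussianProcess X P) {f : Lp ℝ 2 P}
    (hf : f ∈ firstChaos X P) : HasGaussianLaw f P := by
  have := hX.isProbabilityMeasure
  obtain ⟨u, hu, hlim⟩ := mem_closure_iff_seq_limit.1 hf
  have hg : ∀ k, HasGaussianLaw (u k) P := fun k => hasGaussianLaw_of_mem_span hX (hu k)
  have hmean : Filter.Tendsto (fun k => ∫ ω, u k ω ∂P) Filter.atTop (nhds (∫ ω, f ω ∂P)) := by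
    have h1 : ∀ g : Lp ℝ 2 P,
        inner ℝ ((memLp_const (1 : ℝ)).toLp (fun _ : Ω => (1 : ℝ)) : Lp ℝ 2 P) g
          = ∫ ω, g ω ∂P := by
      intro g
      rw [L2.inner_def]
      refine integral_congr_ae ?_
      filter_upwards [(memLp_const (μ := P) (p := 2) (1 : ℝ)).coeFn_toLp] with ω hω
      rw [hω]
      simp
    simp only [← h1]
    exact Filter.Tendsto.inner tendsto_const_nhds hlim
  have hsq : Filter.Tendsto (fun k => ∫ ω, (u k ω) ^ 2 ∂P) Filter.atTop
      (nhds (∫ ω, (f ω) ^ 2 ∂P)) := by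
    have h2 : ∀ g : Lp ℝ 2 P, inner ℝ g g = ∫ ω, (g ω) ^ 2 ∂P := by
      intro g
      rw [L2.inner_def]
      simp [pow_two]
    simp only [← h2]
    exact hlim.inner hlim
  have hm : ∀ g : Lp ℝ 2 P, AEMeasurable g P := fun g => (Lp.aestronglyMeasurable g).aemeasurable
  have hL : ∀ g : Lp ℝ 2 P, MemLp g 2 P := fun g => Lp.memLp g
  rw [hasGaussianLaw_iff_charFun_map_eq (hm f)]
  intro t
  have hchar : Filter.Tendsto (fun k => charFun (P.map (u k)) t) Filter.atTop
      (nhds (charFun (P.map f) t)) := by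
    have h := (tendstoInMeasure_of_tendsto_Lp hlim).tendstoInDistribution (fun k => hm (u k))
    exact (ProbabilityMeasure.tendsto_iff_tendsto_charFun.1 h.tendsto) t
  refine tendsto_nhds_unique hchar ?_
  have heq : ∀ g : Lp ℝ 2 P,
      Complex.exp ((∫ ω, inner ℝ t (g ω) ∂P : ℝ) * Complex.I
        - (Var[fun ω => inner ℝ t (g ω); P] : ℝ) / 2)
      = Complex.exp ((t * ∫ ω, g ω ∂P : ℝ) * Complex.I
        - (t ^ 2 * (∫ ω, (g ω) ^ 2 ∂P - (∫ ω, g ω ∂P) ^ 2) : ℝ) / 2) := by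
    intro g
    have h1 : (fun ω => inner ℝ t (g ω)) = fun ω => t * g ω := by
      ext ω; simp [mul_comm]
    rw [h1, integral_const_mul, variance_const_mul, variance_eq_sub (hL g)]
    rfl
  simp only [(hg _).charFun_map_eq, heq]
  have hcont : Continuous fun x : ℝ × ℝ => Complex.exp ((t * x.1 : ℝ) * Complex.I
        - (t ^ 2 * (x.2 - x.1 ^ 2) : ℝ) / 2) := by fun_prop
  exact (hcont.tendsto _).comp (hmean.prodMk_nhds hsq)

/-- A polynomial of finitely many elements of the first chaos is square integrable. -/
theorem memLp_eval (hX : IsGaussianProcess X P) {σ : Type*} (p : MvPolynomial σ ℝ)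
    (ξ : σ → firstChaos X P) :
    MemLp (fun ω => MvPolynomial.eval (fun i => (ξ i : Lp ℝ 2 P) ω) p) 2 P := by
  have := hX.isProbabilityMeasure
  have hmono : ∀ (i : σ) (q : ℝ≥0∞), q ≠ ∞ → MemLp (ξ i : Lp ℝ 2 P) q P := fun i q hq =>
    (hasGaussianLaw_of_mem_firstChaos hX (ξ i).2).memLp hq
  suffices h : ∀ q : ℝ≥0∞, q ≠ ∞ →
      MemLp (fun ω => MvPolynomial.eval (fun i => (ξ i : Lp ℝ 2 P) ω) p) q P from
    h 2 (by simp)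
  induction p using MvPolynomial.induction_on with
  | C a => intro q _; simpa using memLp_const a
  | add p₁ p₂ h₁ h₂ =>
    intro q hq
    simp only [map_add]
    exact (h₁ q hq).add (h₂ q hq)
  | mul_X p i h =>
    intro q hq
    have hq2 : 2 * q ≠ ∞ := ENNReal.mul_ne_top (by simp) hq
    have : ENNReal.HolderTriple (2 * q) (2 * q) q := ⟨by
      rw [ENNReal.mul_inv (by simp) (by simp), ← add_mul, ENNReal.inv_two_add_inv_two, one_mul]⟩
    simpa using (hmono i _ hq2).mul' (h _ hq2)

/-- The random variable `p(ξ_1, …, ξ_m)`, as an element of `L²(P)`. -/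
def polyEval (hX : IsGaussianProcess X P) {σ : Type*} (p : MvPolynomial σ ℝ)
    (ξ : σ → firstChaos X P) : Lp ℝ 2 P :=
  (memLp_eval hX p ξ).toLp _

/-- The Wick polynomial `:p(ξ_1, …, ξ_m):` of a homogeneous polynomial `p` of degree `n` in
elements of the first chaos: the orthogonal projection of `p(ξ_1, …, ξ_m)` to the `n`-th chaos. -/
def wick (hX : IsGaussianProcess X P) {σ : Type*} (n : ℕ) (p : MvPolynomial σ ℝ)
    (_hp : p.IsHomogeneous n) (ξ : σ → firstChaos X P) : Lp ℝ 2 P :=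
  (chaos X P n).starProjection (polyEval hX p ξ)

theorem isHomogeneous_monomial {σ : Type*} (S : Finset σ) :
    (∏ i ∈ S, (MvPolynomial.X i : MvPolynomial σ ℝ)).IsHomogeneous S.card := by
  simpa using MvPolynomial.IsHomogeneous.prod S (fun i => (MvPolynomial.X i : MvPolynomial σ ℝ))
    (fun _ => 1) (fun i _ => MvPolynomial.isHomogeneous_X ℝ i)

/-- The Wick product `:∏_{i ∈ S} U_i:`, i.e. the Wick polynomial of the homogeneous polynomial
`∏_{i ∈ S} x_i` of degree `|S|`. -/
def wickProd (hX : IsGaussianProcess X P) {σ : Type*} (S : Finset σ)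
    (U : σ → firstChaos X P) : Lp ℝ 2 P :=
  wick hX S.card (∏ i ∈ S, MvPolynomial.X i) (isHomogeneous_monomial S) U

end WickChaos

end

open MeasureTheory ProbabilityTheory
open scoped ENNReal

noncomputable section

namespace WickChaos

/-! Let `H` be the first chaos. In the polynomial ring with one variable `X_h` per `h ∈ H`, let
`D_v` be the derivation with `D_v X_u = ⟪v, u⟫` and put `a_v = X_v - D_v`. The operators `a_v`
commute and satisfy `D_v a_u = a_u D_v + ⟪v, u⟫`. Writing `X_v = a_v + D_v` therefore turns the
recursion into a polynomial identity for `a_{U_1} ⋯ a_{U_n} 1` (`X_mul_wickPoly`).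

It remains to see that this polynomial evaluates to the Wick product (`wickProd_eq_evalLp`). It
differs from `X_{U_1} ⋯ X_{U_n}` by terms of lower degree. Gaussian integration by parts, `E (X_v p)
= E (D_v p)` (`expectation_X_mul`), makes `a_v` adjoint to `D_v`, so the polynomial is orthogonal to
all polynomials of lower degree. Finally, polynomials of degree at most `n` in elements of `H`, not
only in the `X_t`, lie in `H_{≤ n}` (`evalLp_mem_chaosLE`). -/

/-- The polynomials of total degree strictly less than `n`. -/
def degreeLT (σ : Type*) (n : ℕ) : Submodule ℝ (MvPolynomial σ ℝ) :=
  MvPolynomial.restrictSupport ℝ {m | m.degree < n}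

/-! ### Filtration of the polynomial ring by degree. -/

section Degree

variable {σ : Type*}

theorem mem_degreeLT_succ {n : ℕ} {p : MvPolynomial σ ℝ} :
    p ∈ degreeLT σ (n + 1) ↔ p.totalDegree ≤ n := by
  rw [← MvPolynomial.mem_restrictTotalDegree]
  simp only [degreeLT, MvPolynomial.restrictTotalDegree, Nat.lt_succ_iff]
  rfl

/-- The strict bound makes "degree below `0`" the zero space, so inductions on the number of factors
can start at the empty product. -/
theorem mem_degreeLT_zero {p : MvPolynomial σ ℝ} : p ∈ degreeLT σ 0 ↔ p = 0 := by
  simp [degreeLT, MvPolynomial.mem_restrictSupport_iff]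

theorem degreeLT_mono {m n : ℕ} (h : m ≤ n) : degreeLT σ m ≤ degreeLT σ n :=
  MvPolynomial.restrictSupport_mono ℝ fun _ hm => lt_of_lt_of_le hm h

theorem X_mul_mem_degreeLT (i : σ) {n : ℕ} {p : MvPolynomial σ ℝ} (hp : p ∈ degreeLT σ n) :
    MvPolynomial.X i * p ∈ degreeLT σ (n + 1) := by
  cases n with
  | zero => simp [mem_degreeLT_zero.1 hp]
  | succ n =>
    rw [mem_degreeLT_succ] at hp ⊢
    refine (MvPolynomial.totalDegree_mul _ _).trans ?_
    rw [MvPolynomial.totalDegree_X]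
    omega

theorem degreeLT_induction {n : ℕ} {K : Submodule ℝ (MvPolynomial σ ℝ)}
    (h : ∀ m : σ →₀ ℕ, m.degree < n → MvPolynomial.monomial m 1 ∈ K) : degreeLT σ n ≤ K := by
  rw [degreeLT, MvPolynomial.restrictSupport_eq_span, Submodule.span_le]
  rintro _ ⟨m, hm, rfl⟩
  exact h m hm

end Degree

/-! ### Creation operators and Wick polynomials over an inner product space. -/

section Algebra

variable {H : Type*} [NormedAddCommGroup H] [InnerProductSpace ℝ H]

/-- The derivation of `ℝ[X_h : h ∈ H]` with `X_u ↦ ⟪v, u⟫`: the directional derivative along `v`. -/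
def gradient (v : H) : Derivation ℝ (MvPolynomial H ℝ) (MvPolynomial H ℝ) :=
  MvPolynomial.mkDerivation ℝ fun u => MvPolynomial.C (inner ℝ v u)

@[simp]
theorem gradient_X (v u : H) :
    gradient v (MvPolynomial.X u) = MvPolynomial.C (inner ℝ v u) :=
  MvPolynomial.mkDerivation_X _ _ _

theorem gradient_mul (v : H) (p q : MvPolynomial H ℝ) :
    gradient v (p * q) = p * gradient v q + q * gradient v p := by
  simp

theorem gradient_comm (u v : H) (p : MvPolynomial H ℝ) :
    gradient u (gradient v p) = gradient v (gradient u p) := by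
  induction p using MvPolynomial.induction_on with
  | C a => simp
  | add p q hp hq => simp [hp, hq]
  | mul_X p i hp =>
    simp only [gradient_mul, gradient_X, map_add, MvPolynomial.derivation_C, hp]
    ring

theorem gradient_mem_degreeLT (v : H) {n : ℕ} {p : MvPolynomial H ℝ}
    (hp : p ∈ degreeLT H (n + 1)) : gradient v p ∈ degreeLT H n := by
  suffices degreeLT H (n + 1) ≤ (degreeLT H n).comap (gradient v).toLinearMap from this hp
  refine degreeLT_induction fun m hm => ?_
  rw [Submodule.mem_comap]
  change gradient v _ ∈ _
  rw [gradient, MvPolynomial.mkDerivation_monomial, one_smul]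
  refine Submodule.sum_mem _ fun i hi => ?_
  dsimp only
  rw [smul_eq_mul, mul_comm, MvPolynomial.C_mul', degreeLT]
  refine Submodule.smul_mem _ _ ((MvPolynomial.monomial_mem_restrictSupport ℝ).2 (Or.inl ?_))
  have h1 : Finsupp.single i 1 ≤ m := by
    rw [Finsupp.single_le_iff]
    exact Nat.one_le_iff_ne_zero.2 (Finsupp.mem_support_iff.1 hi)
  have h2 := congrArg Finsupp.degree (tsub_add_cancel_of_le h1)
  rw [map_add, Finsupp.degree_single] at h2
  simp only [Set.mem_ofPred_eq]
  omega

/-- The creation operator `p ↦ X_v p - D_v p`. -/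
def creation (v : H) : Module.End ℝ (MvPolynomial H ℝ) :=
  LinearMap.mulLeft ℝ (MvPolynomial.X v) - (gradient v).toLinearMap

theorem creation_apply (v : H) (p : MvPolynomial H ℝ) :
    creation v p = MvPolynomial.X v * p - gradient v p := rfl

/-- In `a_u a_v p` the only term not visibly symmetric is `-⟪u, v⟫ p`, from differentiating `X_v`;
the inner product is symmetric. -/
theorem commute_creation (u v : H) : Commute (creation u) (creation v) := by
  refine LinearMap.ext fun p => ?_
  simp only [Module.End.mul_apply, creation_apply, map_sub, gradient_mul, gradient_X,
    gradient_comm u v p, real_inner_comm u v]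
  ring

variable {σ : Type*}

theorem pairwise_commute_creation (S : Set σ) (U : σ → H) :
    S.Pairwise (Function.onFun Commute fun i => creation (U i)) :=
  fun _ _ _ _ _ => commute_creation _ _

/-- The polynomial in `ℝ[X_h : h ∈ H]` whose evaluation is the Wick product of the `U i`,
`i ∈ S`. -/
def wickPoly (S : Finset σ) (U : σ → H) : MvPolynomial H ℝ :=
  S.noncommProd (fun i => creation (U i)) (pairwise_commute_creation _ U) 1

@[simp]
theorem wickPoly_empty (U : σ → H) : wickPoly ∅ U = 1 := rfl

variable [DecidableEq σ]

theorem wickPoly_insert {S : Finset σ} {i : σ} (hi : i ∉ S) (U : σ → H) :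
    wickPoly (insert i S) U = creation (U i) (wickPoly S U) := by
  rw [wickPoly, Finset.noncommProd_insert_of_notMem _ _ _ _ hi]
  rfl

/-- Moving `D_v` past each `a_u` by `D_v a_u = a_u D_v + ⟪v, u⟫` leaves one contraction per factor,
and `D_v 1 = 0`. -/
theorem gradient_wickPoly (v : H) (S : Finset σ) (U : σ → H) :
    gradient v (wickPoly S U) = ∑ s ∈ S, inner ℝ v (U s) • wickPoly (S.erase s) U := by
  induction S using Finset.induction_on with
  | empty => simp
  | insert i S hi ih =>
    have h : ∑ s ∈ S, inner ℝ v (U s) • wickPoly ((insert i S).erase s) U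
        = creation (U i) (gradient v (wickPoly S U)) := by
      rw [ih, map_sum]
      refine Finset.sum_congr rfl fun s hs => ?_
      have hsi : i ≠ s := fun h => hi (h ▸ hs)
      rw [Finset.erase_insert_of_ne hsi, wickPoly_insert (by simp [hi]), map_smul]
    rw [Finset.sum_insert hi, Finset.erase_insert hi, h, wickPoly_insert hi]
    simp only [creation_apply, map_sub, gradient_mul, gradient_X, gradient_comm v (U i),
      ← MvPolynomial.C_mul']
    ring

theorem X_mul_wickPoly {S : Finset σ} {i : σ} (hi : i ∉ S) (U : σ → H) :
    MvPolynomial.X (U i) * wickPoly S U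
      = wickPoly (insert i S) U + ∑ s ∈ S, inner ℝ (U i) (U s) • wickPoly (S.erase s) U := by
  rw [wickPoly_insert hi, creation_apply, gradient_wickPoly, sub_add_cancel]

/-- The two halves are proved together: the error after a new factor is `X_v` times the old error
plus `D_v` of the old Wick polynomial, whose degree the second half controls. -/
theorem prod_X_sub_wickPoly_mem (S : Finset σ) (U : σ → H) :
    (∏ i ∈ S, MvPolynomial.X (U i)) - wickPoly S U ∈ degreeLT H S.card ∧
      wickPoly S U ∈ degreeLT H (S.card + 1) := by
  induction S using Finset.induction_on with
  | empty => simp [mem_degreeLT_succ]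
  | insert i S hi ih =>
    rw [Finset.prod_insert hi, wickPoly_insert hi, creation_apply, Finset.card_insert_of_notMem hi]
    have h := gradient_mem_degreeLT (U i) ih.2
    constructor
    · rw [← sub_add, ← mul_sub]
      exact add_mem (X_mul_mem_degreeLT _ ih.1) (degreeLT_mono (Nat.le_succ _) h)
    · exact sub_mem (X_mul_mem_degreeLT _ ih.2) (degreeLT_mono (by omega) h)

/-- A linear functional which integrates by parts annihilates the products of a Wick polynomial
with the polynomials of lower degree. -/
theorem wickPoly_orthogonal {E : MvPolynomial H ℝ →ₗ[ℝ] ℝ}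
    (hE : ∀ v p, E (MvPolynomial.X v * p) = E (gradient v p)) (S : Finset σ) (U : σ → H)
    {p : MvPolynomial H ℝ} (hp : p ∈ degreeLT H S.card) : E (wickPoly S U * p) = 0 := by
  induction S using Finset.induction_on generalizing p with
  | empty => simp [mem_degreeLT_zero.1 hp]
  | insert i S hi ih =>
    rw [Finset.card_insert_of_notMem hi] at hp
    -- The product rule gives `E (w D p) + E (p D w)` with `w` the smaller Wick polynomial. The
    -- first term vanishes by induction; the second is cancelled by the `-D` in the creation
    -- operator.
    have h := hE (U i) (wickPoly S U * p)
    rw [gradient_mul, map_add, ih (gradient_mem_degreeLT _ hp), zero_add] at h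
    rw [wickPoly_insert hi, creation_apply, sub_mul, map_sub, mul_assoc, h, mul_comm p, sub_self]

end Algebra

/-! ### Moments of a centered Gaussian on the line. -/

/-- The weight `exp (t x)` makes each integral the `t`-derivative of the preceding one.
Differentiating `J₀ = exp (v t² / 2)` gives `J₁ = v t J₀`, and differentiating further gives the
recursion; `t = 0` yields the moments. -/
theorem integral_pow_mul_exp_gaussianReal (v : NNReal) (n : ℕ) (t : ℝ) :
    ∫ x, x ^ (n + 2) * Real.exp (t * x) ∂gaussianReal 0 v
      = v * (t * ∫ x, x ^ (n + 1) * Real.exp (t * x) ∂gaussianReal 0 v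
        + (n + 1) * ∫ x, x ^ n * Real.exp (t * x) ∂gaussianReal 0 v) := by
  set J : ℕ → ℝ → ℝ := fun n t => ∫ x, x ^ n * Real.exp (t * x) ∂gaussianReal 0 v with hJ
  have hd : ∀ n t, HasDerivAt (J n) (J (n + 1) t) t := fun n t =>
    hasDerivAt_integral_pow_mul_exp_real (X := fun x : ℝ => x) (by simp) n
  change J (n + 2) t = v * (t * J (n + 1) t + (n + 1) * J n t)
  have h0 : ∀ t, J 0 t = Real.exp (v * t ^ 2 / 2) := fun t => by
    have := mgf_gaussianReal (p := gaussianReal 0 v) (X := id) (μ := 0) (v := v) (by simp) t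
    simpa [mgf, hJ] using this
  have h1 : ∀ t, J 1 t = v * (t * J 0 t) := fun t => by
    refine (hd 0 t).unique ?_
    rw [h0 t, funext h0]
    have h2 : HasDerivAt (fun t : ℝ => (v : ℝ) * t ^ 2 / 2) (v * t) t := by
      convert! (((hasDerivAt_id t).pow 2).const_mul (v : ℝ)).div_const 2 using 1
      simp
      ring
    convert! h2.exp using 1
    ring
  induction n generalizing t with
  | zero =>
    have h := (((hasDerivAt_id t).mul (hd 0 t)).const_mul (v : ℝ)).congr_of_eventuallyEq
      (Filter.Eventually.of_forall h1)
    rw [(hd 1 t).unique h]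
    simp only [id_eq, Nat.cast_zero]
    ring
  | succ n ih =>
    have h := ((((hasDerivAt_id t).mul (hd (n + 1) t)).add
      ((hd n t).const_mul ((n : ℝ) + 1))).const_mul (v : ℝ)).congr_of_eventuallyEq
      (Filter.Eventually.of_forall ih)
    rw [(hd (n + 2) t).unique h]
    simp only [id_eq, Nat.cast_add, Nat.cast_one]
    ring

theorem integral_pow_gaussianReal (v : NNReal) (n : ℕ) :
    ∫ x, x ^ (n + 2) ∂gaussianReal 0 v = v * ((n + 1) * ∫ x, x ^ n ∂gaussianReal 0 v) := by
  simpa using integral_pow_mul_exp_gaussianReal v n 0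

/-! ### Expectation of polynomials in the first chaos, and integration by parts. -/

variable {Ω T : Type*} [MeasurableSpace Ω] {X : T → Ω → ℝ} {P : Measure Ω}

/-- Zero mean is orthogonality to the constant `1`, a closed condition, so it passes from the `X_t`
to the closed span. -/
theorem integral_eq_zero_of_mem_firstChaos [IsProbabilityMeasure P]
    (hmean : ∀ t, ∫ ω, X t ω ∂P = 0) (f : firstChaos X P) : ∫ ω, (f : Lp ℝ 2 P) ω ∂P = 0 := by
  have h1 : ∀ g : Lp ℝ 2 P, inner ℝ g ((memLp_const (1 : ℝ)).toLp (fun _ : Ω => (1 : ℝ)))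
      = ∫ ω, g ω ∂P := by
    intro g
    rw [L2.inner_def]
    refine integral_congr_ae ?_
    filter_upwards [(memLp_const (μ := P) (p := 2) (1 : ℝ)).coeFn_toLp] with ω hω
    rw [hω]
    simp
  have h2 : (f : Lp ℝ 2 P) ∈ (ℝ ∙ ((memLp_const (μ := P) (p := 2) (1 : ℝ)).toLp
      (fun _ : Ω => (1 : ℝ))))ᗮ := by
    refine Submodule.topologicalClosure_minimal _ ?_ (Submodule.isClosed_orthogonal _) f.2
    rw [Submodule.span_le]
    rintro g ⟨t, ht⟩
    rw [SetLike.mem_coe, Submodule.mem_orthogonal_singleton_iff_inner_left, h1,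
      integral_congr_ae ht, hmean t]
  rw [← h1]
  exact Submodule.mem_orthogonal_singleton_iff_inner_left.1 h2

theorem firstChaos_inner_def (u v : firstChaos X P) :
    inner ℝ u v = ∫ ω, (u : Lp ℝ 2 P) ω * (v : Lp ℝ 2 P) ω ∂P := by
  rw [Submodule.coe_inner, L2.inner_def]
  simp [mul_comm]

theorem firstChaos_add_ae (u v : firstChaos X P) :
    ((u + v : firstChaos X P) : Lp ℝ 2 P) =ᵐ[P]
      fun ω => (u : Lp ℝ 2 P) ω + (v : Lp ℝ 2 P) ω :=
  Lp.coeFn_add _ _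

theorem firstChaos_smul_ae (c : ℝ) (u : firstChaos X P) :
    ((c • u : firstChaos X P) : Lp ℝ 2 P) =ᵐ[P] fun ω => c * (u : Lp ℝ 2 P) ω :=
  Lp.coeFn_smul _ _

/-- Every linear functional of a finite subfamily is again an element of the first chaos, hence
Gaussian. -/
theorem isGaussianProcess_firstChaos (hX : IsGaussianProcess X P) :
    IsGaussianProcess (fun h : firstChaos X P => ((h : Lp ℝ 2 P) : Ω → ℝ)) P where
  hasGaussianLaw I := by
    classical
    have hm : Measurable fun ω => I.restrict fun h : firstChaos X P => (h : Lp ℝ 2 P) ω :=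
      measurable_pi_lambda _ fun h => (Lp.stronglyMeasurable _).measurable
    refine ⟨isGaussian_of_map_eq_gaussianReal fun L => ?_⟩
    have h : HasGaussianLaw (fun ω => L (I.restrict fun h : firstChaos X P =>
        (h : Lp ℝ 2 P) ω)) P := by
      refine HasGaussianLaw.congr (hasGaussianLaw_of_mem_firstChaos hX
        (∑ i : I, L (Pi.single i 1) • (i : firstChaos X P)).2) ?_
      rw [Submodule.coe_sum]
      have h2 : ∀ᵐ ω ∂P, ∀ i : I, ((L (Pi.single i 1) • (i : firstChaos X P) : firstChaos X P) :
          Lp ℝ 2 P) ω = L (Pi.single i 1) * ((i : firstChaos X P) : Lp ℝ 2 P) ω :=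
        ae_all_iff.2 fun i => firstChaos_smul_ae _ _
      filter_upwards [Lp.coeFn_finsetSum Finset.univ (fun i : I =>
        ((L (Pi.single i 1) • (i : firstChaos X P) : firstChaos X P) : Lp ℝ 2 P)), h2] with ω h1 h2
      rw [h1, Finset.sum_apply]
      simp only [h2]
      conv_rhs => rw [← Finset.univ_sum_single
        (I.restrict fun h : firstChaos X P => (h : Lp ℝ 2 P) ω), map_sum]
      refine Finset.sum_congr rfl fun i _ => ?_
      rw [mul_comm, ← smul_eq_mul, ← map_smul]
      congr 1
      ext j
      simp [Pi.single_apply]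
    rw [Measure.map_map (by fun_prop) hm]
    exact ⟨_, _, h.map_eq_gaussianReal⟩

/-- The expectation of a polynomial in the elements of the first chaos, as a linear functional. -/
def expectation (hX : IsGaussianProcess X P) : MvPolynomial (firstChaos X P) ℝ →ₗ[ℝ] ℝ where
  toFun p := ∫ ω, MvPolynomial.eval (fun h : firstChaos X P => (h : Lp ℝ 2 P) ω) p ∂P
  map_add' p q := by
    have := hX.isProbabilityMeasure
    simp only [map_add]
    exact integral_add ((memLp_eval hX p _root_.id).integrable (by norm_num))
      ((memLp_eval hX q _root_.id).integrable (by norm_num))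
  map_smul' c p := by
    simp only [MvPolynomial.smul_eval, integral_const_mul]
    rfl

theorem expectation_apply (hX : IsGaussianProcess X P) (p : MvPolynomial (firstChaos X P) ℝ) :
    expectation hX p
      = ∫ ω, MvPolynomial.eval (fun h : firstChaos X P => (h : Lp ℝ 2 P) ω) p ∂P := rfl

/-- This is integration by parts for `p = X_v ^ k`. At `k = 0` the truncated exponent `k - 1` is
harmless because of the factor `k`. -/
theorem expectation_X_pow [IsProbabilityMeasure P] (hX : IsGaussianProcess X P)
    (hmean : ∀ t, ∫ ω, X t ω ∂P = 0) (v : firstChaos X P) (k : ℕ) :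
    expectation hX (MvPolynomial.X v ^ (k + 1))
      = inner ℝ v v * (k * expectation hX (MvPolynomial.X v ^ (k - 1))) := by
  have hm := integral_eq_zero_of_mem_firstChaos hmean v
  have hlaw := (hasGaussianLaw_of_mem_firstChaos hX v.2)
  have hvar : (Var[(v : Lp ℝ 2 P); P].toNNReal : ℝ) = inner ℝ v v := by
    rw [Real.coe_toNNReal _ (variance_nonneg _ _), variance_eq_sub hlaw.memLp_two, hm,
      firstChaos_inner_def]
    simp [pow_two]
  have h : ∀ n, expectation hX (MvPolynomial.X v ^ n)
      = ∫ x, x ^ n ∂gaussianReal 0 Var[(v : Lp ℝ 2 P); P].toNNReal := fun n => by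
    rw [← hm, ← hlaw.map_eq_gaussianReal,
      integral_map hlaw.aemeasurable (by fun_prop), expectation_apply]
    simp
  rw [h, h, ← hvar]
  cases k with
  | zero => simp
  | succ k => simpa only [Nat.cast_add, Nat.cast_one, add_tsub_cancel_right] using!
      integral_pow_gaussianReal _ k

/-- `X_{u+v}` and `X_u + X_v` are different polynomials; they agree only almost surely after
evaluation. -/
theorem expectation_mul_X_add (hX : IsGaussianProcess X P) (q : MvPolynomial (firstChaos X P) ℝ)
    (u v : firstChaos X P) :
    expectation hX (q * MvPolynomial.X (u + v))
      = expectation hX (q * MvPolynomial.X u) + expectation hX (q * MvPolynomial.X v) := by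
  rw [← map_add, ← mul_add]
  simp only [expectation_apply]
  refine integral_congr_ae ?_
  filter_upwards [firstChaos_add_ae u v] with ω h
  simp only [map_mul, map_add, MvPolynomial.eval_X, h]

theorem expectation_mul_X_smul (hX : IsGaussianProcess X P) (q : MvPolynomial (firstChaos X P) ℝ)
    (c : ℝ) (v : firstChaos X P) :
    expectation hX (q * MvPolynomial.X (c • v)) = c * expectation hX (q * MvPolynomial.X v) := by
  rw [← smul_eq_mul c, ← map_smul]
  simp only [expectation_apply]
  refine integral_congr_ae ?_
  filter_upwards [firstChaos_smul_ae c v] with ω h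
  simp only [map_mul, MvPolynomial.smul_eval, MvPolynomial.eval_X, h]
  ring

theorem indepFun_of_inner_eq_zero [IsProbabilityMeasure P] (hX : IsGaussianProcess X P)
    (hmean : ∀ t, ∫ ω, X t ω ∂P = 0) {σ : Type*} (v : firstChaos X P) (w : σ → firstChaos X P)
    (hw : ∀ i, inner ℝ v (w i) = 0) :
    IndepFun (fun ω (_ : Unit) => (v : Lp ℝ 2 P) ω) (fun ω i => (w i : Lp ℝ 2 P) ω) P := by
  have hm : ∀ u : firstChaos X P, AEMeasurable (u : Lp ℝ 2 P) P := fun u =>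
    (Lp.stronglyMeasurable _).measurable.aemeasurable
  refine IsGaussianProcess.indepFun_of_covariance_eq_zero (X := fun _ : Unit => ⇑(v : Lp ℝ 2 P))
    (Y := fun i => ⇑(w i : Lp ℝ 2 P)) ?_ (fun _ => hm _) (fun i => hm _) fun _ i => ?_
  · have h := (isGaussianProcess_firstChaos hX).comp_right
      (Sum.elim (fun _ : Unit => v) w)
    convert! h using 1
    ext s ω
    cases s <;> rfl
  · rw [covariance_eq_sub (Lp.memLp _) (Lp.memLp _), integral_eq_zero_of_mem_firstChaos hmean,
      zero_mul, sub_zero]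
    exact (firstChaos_inner_def _ _).symm.trans (hw i)

theorem measurable_eval {σ : Type*} (p : MvPolynomial σ ℝ) :
    Measurable fun x : σ → ℝ => MvPolynomial.eval x p := by
  induction p using MvPolynomial.induction_on with
  | C a => simp
  | add p q hp hq => simpa using! hp.add hq
  | mul_X p i hp => simpa using! hp.mul (measurable_pi_apply i)

theorem expectation_X_pow_mul_of_inner_eq_zero [IsProbabilityMeasure P]
    (hX : IsGaussianProcess X P) (hmean : ∀ t, ∫ ω, X t ω ∂P = 0) {σ : Type*}
    (v : firstChaos X P) (w : σ → firstChaos X P) (hw : ∀ i, inner ℝ v (w i) = 0)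
    (k : ℕ) (g : MvPolynomial σ ℝ) :
    expectation hX (MvPolynomial.X v ^ k * MvPolynomial.rename w g)
      = expectation hX (MvPolynomial.X v ^ k) * expectation hX (MvPolynomial.rename w g) := by
  have hm : ∀ u : firstChaos X P, Measurable (u : Lp ℝ 2 P) := fun u =>
    (Lp.stronglyMeasurable _).measurable
  have h := (indepFun_of_inner_eq_zero hX hmean v w hw).integral_fun_comp_mul_comp
    (f := fun x => x () ^ k) (g := fun y => MvPolynomial.eval y g)
    (measurable_pi_lambda _ fun _ => hm _).aemeasurable
    (measurable_pi_lambda _ fun _ => hm _).aemeasurable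
    ((measurable_pi_apply ()).pow_const k).aestronglyMeasurable
    (measurable_eval g).aestronglyMeasurable
  simp only [expectation_apply]
  simpa [MvPolynomial.eval_rename, Function.comp_def] using h

/-- Gaussian integration by parts. -/
theorem expectation_X_mul [IsProbabilityMeasure P] (hX : IsGaussianProcess X P)
    (hmean : ∀ t, ∫ ω, X t ω ∂P = 0) (v : firstChaos X P)
    (p : MvPolynomial (firstChaos X P) ℝ) :
    expectation hX (MvPolynomial.X v * p) = expectation hX (gradient v p) := by
  -- Each `u` splits as `a u • v + w u` with `w u` orthogonal to, hence independent of, `v`. For `v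
  -- = 0` division by zero gives `a = 0`.
  set a : firstChaos X P → ℝ := fun u => inner ℝ v u / inner ℝ v v with ha
  set w : firstChaos X P → firstChaos X P := fun u => u - a u • v with hw
  have hsmul : ∀ c : ℝ, inner ℝ v (c • v) = c * inner ℝ v v := fun c => inner_smul_right v v c
  have hvw : ∀ u, inner ℝ v (w u) = 0 := fun u => by
    rw [hw, inner_sub_right, hsmul, ha]
    rcases eq_or_ne v 0 with rfl | hv
    · simp
    · rw [div_mul_cancel₀ _ (inner_self_ne_zero.2 hv), sub_self]
  have huw : ∀ u, u = a u • v + w u := fun u => by simp [hw]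
  have hsplit : ∀ q u, expectation hX (q * MvPolynomial.X u)
      = a u * expectation hX (q * MvPolynomial.X v)
        + expectation hX (q * MvPolynomial.X (w u)) := fun q u => by
    conv_lhs => rw [huw u]
    rw [expectation_mul_X_add, expectation_mul_X_smul]
  have hgrad : ∀ g : MvPolynomial (firstChaos X P) ℝ,
      gradient v (MvPolynomial.rename w g) = 0 := fun g => by
    induction g using MvPolynomial.induction_on with
    | C a => simp
    | add p q hp hq => simp [hp, hq]
    | mul_X p i hp => simp [hp, hvw]
  -- The prefactor collects the variables of `p` already split: powers of `X_v`, and a polynomial in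
  -- the `w u`, which `D_v` kills. For constant `p`, independence reduces the claim to the moment
  -- recursion.
  suffices h : ∀ (k : ℕ) (g : MvPolynomial (firstChaos X P) ℝ),
      expectation hX (MvPolynomial.X v * (MvPolynomial.X v ^ k * MvPolynomial.rename w g * p))
        = expectation hX (gradient v (MvPolynomial.X v ^ k * MvPolynomial.rename w g * p)) by
    simpa using h 0 1
  induction p using MvPolynomial.induction_on with
  | C c =>
    intro k g
    rw [mul_comm _ (MvPolynomial.C c), MvPolynomial.C_mul', mul_smul_comm, map_smul,
      Derivation.map_smul, map_smul, ← mul_assoc, ← pow_succ', gradient_mul, hgrad, mul_zero, zero_add,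
      Derivation.leibniz_pow, gradient_X,
      expectation_X_pow_mul_of_inner_eq_zero hX hmean v w hvw, expectation_X_pow hX hmean]
    have h : MvPolynomial.rename w g * (k • (MvPolynomial.X v ^ (k - 1) :
        MvPolynomial (firstChaos X P) ℝ) • MvPolynomial.C (inner ℝ v v))
        = (inner ℝ v v * k) • (MvPolynomial.X v ^ (k - 1) * MvPolynomial.rename w g) := by
      rw [← MvPolynomial.C_mul']
      simp only [smul_eq_mul, nsmul_eq_mul, map_mul, map_natCast]
      ring
    rw [h, map_smul, expectation_X_pow_mul_of_inner_eq_zero hX hmean v w hvw]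
    simp only [smul_eq_mul]
    ring
  | add p q hp hq =>
    intro k g
    simp only [mul_add, map_add, hp, hq]
  | mul_X p u hp =>
    intro k g
    set q := MvPolynomial.X v ^ k * MvPolynomial.rename w g * p with hq
    -- The component of `u` along `v` raises `k`; the orthogonal one enters `g`.
    have h1 := hp (k + 1) g
    have h2 := hp k (g * MvPolynomial.X u)
    have e1 : MvPolynomial.X v ^ (k + 1) * MvPolynomial.rename w g * p = q * MvPolynomial.X v := by
      rw [hq]; ring
    have e2 : MvPolynomial.X v ^ k * MvPolynomial.rename w (g * MvPolynomial.X u) * p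
        = q * MvPolynomial.X (w u) := by
      rw [hq, map_mul, MvPolynomial.rename_X]; ring
    rw [e1] at h1
    rw [e2] at h2
    have hc : (inner ℝ v u : ℝ) = a u * inner ℝ v v := by
      conv_lhs => rw [huw u, inner_add_right, hsmul, hvw, add_zero]
    rw [← mul_assoc _ p, ← hq]
    clear_value q
    rw [← mul_assoc, hsplit, mul_assoc _ q, mul_assoc _ q, h1, h2]
    simp only [gradient_mul, gradient_X, map_add, hvw, hc, map_mul, map_zero, mul_zero, zero_add]
    rw [mul_comm (MvPolynomial.X u), hsplit, mul_left_comm q, MvPolynomial.C_mul', map_smul,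
      mul_comm (MvPolynomial.X v) (gradient v q),
      mul_comm (MvPolynomial.X (w u)) (gradient v q), smul_eq_mul]
    ring

/-! ### Evaluation in `L²` and passage to the closure. -/

/-- The evaluation of the polynomials in the elements of the first chaos, as a linear map to
`L²(P)`. -/
def evalLp (hX : IsGaussianProcess X P) : MvPolynomial (firstChaos X P) ℝ →ₗ[ℝ] Lp ℝ 2 P where
  toFun p := polyEval hX p _root_.id
  map_add' p q := by
    rw [polyEval, polyEval, polyEval, ← MemLp.toLp_add]
    exact MemLp.toLp_congr _ _ (.of_forall fun ω => by simp)
  map_smul' c p := by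
    rw [polyEval, polyEval, RingHom.id_apply, ← MemLp.toLp_const_smul]
    exact MemLp.toLp_congr _ _ (.of_forall fun ω => by simp)

theorem evalLp_ae (hX : IsGaussianProcess X P) (p : MvPolynomial (firstChaos X P) ℝ) :
    evalLp hX p =ᵐ[P]
      fun ω => MvPolynomial.eval (fun h : firstChaos X P => (h : Lp ℝ 2 P) ω) p :=
  MemLp.coeFn_toLp (memLp_eval hX p _root_.id)

theorem evalLp_congr (hX : IsGaussianProcess X P) {p q : MvPolynomial (firstChaos X P) ℝ}
    (h : ∀ᵐ ω ∂P, MvPolynomial.eval (fun h : firstChaos X P => (h : Lp ℝ 2 P) ω) p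
      = MvPolynomial.eval (fun h : firstChaos X P => (h : Lp ℝ 2 P) ω) q) :
    evalLp hX p = evalLp hX q :=
  MemLp.toLp_congr (memLp_eval hX p _root_.id) (memLp_eval hX q _root_.id) h

theorem polyEval_eq_evalLp (hX : IsGaussianProcess X P) {σ : Type*} (p : MvPolynomial σ ℝ)
    (U : σ → firstChaos X P) : polyEval hX p U = evalLp hX (MvPolynomial.rename U p) :=
  MemLp.toLp_congr (memLp_eval hX p U) (memLp_eval hX _ _root_.id) (.of_forall fun ω => by
    simp [MvPolynomial.eval_rename, Function.comp_def])

theorem inner_evalLp (hX : IsGaussianProcess X P) (p q : MvPolynomial (firstChaos X P) ℝ) :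
    inner ℝ (evalLp hX p) (evalLp hX q) = expectation hX (p * q) := by
  rw [L2.inner_def, expectation_apply]
  refine integral_congr_ae ?_
  filter_upwards [evalLp_ae hX p, evalLp_ae hX q] with ω h1 h2
  rw [h1, h2]
  simp [mul_comm]

theorem evalLp_mul_X_add (hX : IsGaussianProcess X P) (q : MvPolynomial (firstChaos X P) ℝ)
    (u v : firstChaos X P) :
    evalLp hX (q * MvPolynomial.X (u + v))
      = evalLp hX (q * MvPolynomial.X u) + evalLp hX (q * MvPolynomial.X v) := by
  rw [← map_add, ← mul_add]
  refine evalLp_congr hX ?_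
  filter_upwards [firstChaos_add_ae u v] with ω h
  simp only [map_mul, map_add, MvPolynomial.eval_X, h]

theorem evalLp_mul_X_smul (hX : IsGaussianProcess X P) (q : MvPolynomial (firstChaos X P) ℝ)
    (c : ℝ) (v : firstChaos X P) :
    evalLp hX (q * MvPolynomial.X (c • v)) = c • evalLp hX (q * MvPolynomial.X v) := by
  rw [← map_smul]
  refine evalLp_congr hX ?_
  filter_upwards [firstChaos_smul_ae c v] with ω h
  simp only [map_mul, MvPolynomial.smul_eval, MvPolynomial.eval_X, h]
  ring

theorem norm_evalLp_X_sq_le [IsProbabilityMeasure P] (hX : IsGaussianProcess X P)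
    (hmean : ∀ t, ∫ ω, X t ω ∂P = 0) (v : firstChaos X P) :
    ‖evalLp hX (MvPolynomial.X v ^ 2)‖ ≤ 2 * ‖v‖ ^ 2 := by
  refine abs_le_of_sq_le_sq' ?_ (by positivity) |>.2
  -- Together these give `E v⁴ = 3 ‖v‖⁴ ≤ (2 ‖v‖²)²`.
  have h4 := expectation_X_pow hX hmean v 3
  have h2 := expectation_X_pow hX hmean v 1
  have h0 : expectation hX (MvPolynomial.X v ^ 0) = 1 := by simp [expectation_apply]
  rw [real_inner_self_eq_norm_sq] at h4 h2
  norm_num [-AddSubgroupClass.coe_norm, -Submodule.coe_norm] at h4 h2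
  rw [pow_zero] at h0
  rw [← real_inner_self_eq_norm_sq, inner_evalLp, ← pow_add, h4, h2, h0]
  nlinarith [sq_nonneg (‖v‖ ^ 2)]

/-- By Cauchy–Schwarz, `‖q v‖² = ⟪q², v²⟫ ≤ 2 c ‖v‖²` with `c = ‖q²‖`, and `2 c ≤ (c + 1)²`. This
bound is what lets a factor from the first chaos be approximated. -/
theorem norm_evalLp_mul_X_le [IsProbabilityMeasure P] (hX : IsGaussianProcess X P)
    (hmean : ∀ t, ∫ ω, X t ω ∂P = 0) (q : MvPolynomial (firstChaos X P) ℝ)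
    (v : firstChaos X P) :
    ‖evalLp hX (q * MvPolynomial.X v)‖ ≤ (‖evalLp hX (q ^ 2)‖ + 1) * ‖v‖ := by
  refine abs_le_of_sq_le_sq' ?_ (by positivity) |>.2
  have h : ‖evalLp hX (q * MvPolynomial.X v)‖ ^ 2
      = inner ℝ (evalLp hX (q ^ 2)) (evalLp hX (MvPolynomial.X v ^ 2)) := by
    rw [← real_inner_self_eq_norm_sq, inner_evalLp, inner_evalLp]
    congr 1
    ring
  calc _ ≤ ‖evalLp hX (q ^ 2)‖ * ‖evalLp hX (MvPolynomial.X v ^ 2)‖ :=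
        h.trans_le (real_inner_le_norm _ _)
    _ ≤ ‖evalLp hX (q ^ 2)‖ * (2 * ‖v‖ ^ 2) := by
        gcongr
        exact norm_evalLp_X_sq_le hX hmean v
    _ ≤ _ := by
        rw [mul_pow]
        nlinarith [mul_nonneg (add_nonneg (sq_nonneg ‖evalLp hX (q ^ 2)‖) zero_le_one)
          (sq_nonneg ‖v‖)]

/-- The map `v ↦ q X_v`, as a bounded operator from the first chaos to `L²(P)`. -/
def mulX [IsProbabilityMeasure P] (hX : IsGaussianProcess X P)
    (hmean : ∀ t, ∫ ω, X t ω ∂P = 0) (q : MvPolynomial (firstChaos X P) ℝ) :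
    firstChaos X P →L[ℝ] Lp ℝ 2 P :=
  LinearMap.mkContinuous
    { toFun := fun v => evalLp hX (q * MvPolynomial.X v)
      map_add' := evalLp_mul_X_add hX q
      map_smul' := evalLp_mul_X_smul hX q }
    (‖evalLp hX (q ^ 2)‖ + 1) (norm_evalLp_mul_X_le hX hmean q)

/-- The variable `X t` as an element of the first chaos. -/
def generator (hX : IsGaussianProcess X P) (t : T) : firstChaos X P :=
  ⟨(hX.hasGaussianLaw_eval t).memLp_two.toLp (X t),
    Submodule.le_topologicalClosure _ (Submodule.subset_span ⟨t, MemLp.coeFn_toLp (hX.hasGaussianLaw_eval t).memLp_two⟩)⟩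

theorem generator_ae (hX : IsGaussianProcess X P) (t : T) :
    (generator hX t : Lp ℝ 2 P) =ᵐ[P] X t :=
  MemLp.coeFn_toLp (hX.hasGaussianLaw_eval t).memLp_two

theorem evalLp_rename_generator_ae (hX : IsGaussianProcess X P) (q : MvPolynomial T ℝ) :
    evalLp hX (MvPolynomial.rename (generator hX) q) =ᵐ[P]
      fun ω => MvPolynomial.eval (fun t => X t ω) q := by
  have h : (fun ω => MvPolynomial.eval (fun t => (generator hX t : Lp ℝ 2 P) ω) q) =ᵐ[P]
      fun ω => MvPolynomial.eval (fun t => X t ω) q := by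
    -- Only the finitely many variables of `q` matter, so `T` may be uncountable.
    have h1 : ∀ᵐ ω ∂P, ∀ t ∈ q.vars, (generator hX t : Lp ℝ 2 P) ω = X t ω :=
      (ae_ball_iff q.vars.countable_toSet).2 fun t _ => generator_ae hX t
    filter_upwards [h1] with ω h1
    exact MvPolynomial.eval₂Hom_congr' rfl (fun t ht _ => h1 t ht) rfl
  filter_upwards [evalLp_ae hX (MvPolynomial.rename (generator hX) q), h] with ω h1 h2
  rw [h1, ← h2, MvPolynomial.eval_rename]
  rfl

theorem evalLp_mul_X_mem [IsProbabilityMeasure P] (hX : IsGaussianProcess X P)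
    (hmean : ∀ t, ∫ ω, X t ω ∂P = 0) {K : Submodule ℝ (Lp ℝ 2 P)}
    (hK : IsClosed (K : Set (Lp ℝ 2 P))) {q : MvPolynomial (firstChaos X P) ℝ}
    (h : ∀ t, evalLp hX (q * MvPolynomial.X (generator hX t)) ∈ K) (v : firstChaos X P) :
    evalLp hX (q * MvPolynomial.X v) ∈ K := by
  have hspan : ∀ g ∈ Submodule.span ℝ {f : Lp ℝ 2 P | ∃ t : T, f =ᵐ[P] X t},
      ∀ hg : g ∈ firstChaos X P, mulX hX hmean q ⟨g, hg⟩ ∈ K := by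
    intro g hg
    induction hg using Submodule.span_induction with
    | mem f hf =>
      intro hg
      obtain ⟨t, ht⟩ := hf
      have : (⟨f, hg⟩ : firstChaos X P) = generator hX t :=
        Subtype.ext (Lp.ext (ht.trans (generator_ae hX t).symm))
      rw [this]
      exact h t
    | zero =>
      intro hg
      have : (⟨0, hg⟩ : firstChaos X P) = 0 := rfl
      rw [this, map_zero]
      exact K.zero_mem
    | add f g hf hg hf' hg' =>
      intro hfg
      have h1 := Submodule.le_topologicalClosure _ hf
      have h2 := Submodule.le_topologicalClosure _ hg
      have : (⟨f + g, hfg⟩ : firstChaos X P) = ⟨f, h1⟩ + ⟨g, h2⟩ := rfl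
      rw [this, map_add]
      exact K.add_mem (hf' h1) (hg' h2)
    | smul c f hf hf' =>
      intro hcf
      have h1 := Submodule.le_topologicalClosure _ hf
      have : (⟨c • f, hcf⟩ : firstChaos X P) = c • ⟨f, h1⟩ := rfl
      rw [this, map_smul]
      exact K.smul_mem c (hf' h1)
  obtain ⟨u, hu, hlim⟩ := mem_closure_iff_seq_limit.1 v.2
  have hu' : ∀ k, u k ∈ firstChaos X P := fun k => Submodule.le_topologicalClosure _ (hu k)
  have hlim' : Filter.Tendsto (fun k => (⟨u k, hu' k⟩ : firstChaos X P)) Filter.atTop (nhds v) :=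
    tendsto_subtype_rng.2 hlim
  exact hK.mem_of_tendsto (((mulX hX hmean q).continuous.tendsto v).comp hlim')
    (.of_forall fun k => hspan _ (hu k) _)

/-- One factor is approximated at a time: by `evalLp_mul_X_mem` it may be taken to be some `X_t`,
which is then absorbed into `q` at the cost of one degree. -/
theorem evalLp_rename_mul_prod_mem_chaosLE [IsProbabilityMeasure P] (hX : IsGaussianProcess X P)
    (hmean : ∀ t, ∫ ω, X t ω ∂P = 0) (s : Multiset (firstChaos X P)) {n : ℕ}
    {q : MvPolynomial T ℝ} (hq : q.totalDegree ≤ n) :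
    evalLp hX (MvPolynomial.rename (generator hX) q * (s.map MvPolynomial.X).prod)
      ∈ chaosLE X P (n + s.card) := by
  induction s using Multiset.induction_on generalizing n q with
  | empty =>
    refine Submodule.le_topologicalClosure _ ⟨q, hq, ?_⟩
    simpa using evalLp_rename_generator_ae hX q
  | cons v s ih =>
    rw [Multiset.map_cons, Multiset.prod_cons, mul_left_comm, mul_comm]
    refine evalLp_mul_X_mem hX hmean (Submodule.isClosed_topologicalClosure _) (fun t => ?_) v
    have hd : (q * MvPolynomial.X t).totalDegree ≤ n + 1 := by
      refine (MvPolynomial.totalDegree_mul _ _).trans ?_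
      rw [MvPolynomial.totalDegree_X]
      omega
    have h := ih hd
    rw [map_mul (MvPolynomial.rename _), MvPolynomial.rename_X, mul_right_comm] at h
    rwa [Multiset.card_cons, add_comm s.card, ← add_assoc]

theorem evalLp_mem_chaosLE [IsProbabilityMeasure P] (hX : IsGaussianProcess X P)
    (hmean : ∀ t, ∫ ω, X t ω ∂P = 0) {n : ℕ} {p : MvPolynomial (firstChaos X P) ℝ}
    (hp : p ∈ degreeLT (firstChaos X P) (n + 1)) : evalLp hX p ∈ chaosLE X P n := by
  classical
  suffices degreeLT (firstChaos X P) (n + 1) ≤ (chaosLE X P n).comap (evalLp hX) from this hp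
  refine degreeLT_induction fun m hm => ?_
  have h := evalLp_rename_mul_prod_mem_chaosLE hX hmean (Finsupp.toMultiset m)
    (n := n - m.degree) (q := 1) (by simp)
  rw [map_one, one_mul, Finset.prod_multiset_map_count, Finsupp.toFinset_toMultiset,
    Finsupp.card_toMultiset] at h
  simp only [Finsupp.count_toMultiset] at h
  rw [Submodule.mem_comap, ← MvPolynomial.prod_X_pow_eq_monomial]
  have e : n - m.degree + m.sum (fun _ => _root_.id) = n :=
    Nat.sub_add_cancel (Nat.lt_succ_iff.1 hm)
  rwa [e] at h

/-! ### Wick products as evaluated Wick polynomials, and the recursion. -/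

theorem evalLp_wickPoly_mem_orthogonal [IsProbabilityMeasure P] (hX : IsGaussianProcess X P)
    (hmean : ∀ t, ∫ ω, X t ω ∂P = 0) {σ : Type*} [DecidableEq σ] {S : Finset σ} {k : ℕ}
    (hS : S.card = k + 1) (U : σ → firstChaos X P) :
    evalLp hX (wickPoly S U) ∈ (chaosLE X P k)ᗮ := by
  rw [chaosLE, Submodule.orthogonal_closure, Submodule.mem_orthogonal']
  rintro f ⟨q, hq, hf⟩
  have hfq : f = evalLp hX (MvPolynomial.rename (generator hX) q) :=
    Lp.ext (hf.trans (evalLp_rename_generator_ae hX q).symm)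
  rw [hfq, inner_evalLp]
  refine wickPoly_orthogonal (expectation_X_mul hX hmean) S U ?_
  rw [hS, mem_degreeLT_succ]
  exact (MvPolynomial.totalDegree_rename_le _ _).trans hq

theorem wickProd_eq_evalLp [IsProbabilityMeasure P] (hX : IsGaussianProcess X P)
    (hmean : ∀ t, ∫ ω, X t ω ∂P = 0) {σ : Type*} [DecidableEq σ] (S : Finset σ)
    (U : σ → firstChaos X P) : wickProd hX S U = evalLp hX (wickPoly S U) := by
  obtain ⟨h1, h2⟩ := prod_X_sub_wickPoly_mem S U
  rw [wickProd, wick, polyEval_eq_evalLp, map_prod]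
  simp only [MvPolynomial.rename_X]
  have hmem := evalLp_mem_chaosLE hX hmean h2
  generalize hk : S.card = k at h1 hmem
  cases k with
  -- `H₀` carries no orthogonality condition, but here the product and the Wick polynomial coincide.
  | zero =>
    rw [sub_eq_zero.1 (mem_degreeLT_zero.1 h1)]
    exact Submodule.starProjection_eq_self_iff.2 hmem
  | succ k =>
    refine Submodule.eq_starProjection_of_mem_orthogonal
      ⟨hmem, evalLp_wickPoly_mem_orthogonal hX hmean hk U⟩ ?_
    rw [← map_sub]
    -- The error lies in `H_{≤ k}`, to which `H_{k+1}` is orthogonal by definition.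
    exact Submodule.orthogonal_le inf_le_right
      (Submodule.le_orthogonal_orthogonal _ (evalLp_mem_chaosLE hX hmean h1))

/-- The recursion for Wick products: `:∏_{i ∈ S} U_i: U_j` for an index `j ∉ S`. -/
theorem wickProd_mul [IsProbabilityMeasure P] (hX : IsGaussianProcess X P)
    (hmean : ∀ t, ∫ ω, X t ω ∂P = 0) {σ : Type*} [DecidableEq σ] {S : Finset σ} {j : σ}
    (hj : j ∉ S) (U : σ → firstChaos X P) :
    ∀ᵐ ω ∂P, wickProd hX S U ω * (U j : Lp ℝ 2 P) ω
      = wickProd hX (insert j S) U ω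
        + ∑ s ∈ S, wickProd hX (S.erase s) U ω
          * ∫ ω', (U s : Lp ℝ 2 P) ω' * (U j : Lp ℝ 2 P) ω' ∂P := by
  simp only [wickProd_eq_evalLp hX hmean]
  have h : ∀ᵐ ω ∂P, ∀ s ∈ S, evalLp hX (wickPoly (S.erase s) U) ω
      = MvPolynomial.eval (fun h : firstChaos X P => (h : Lp ℝ 2 P) ω)
        (wickPoly (S.erase s) U) :=
    (ae_ball_iff S.countable_toSet).2 fun s _ => evalLp_ae hX _
  filter_upwards [evalLp_ae hX (wickPoly S U), evalLp_ae hX (wickPoly (insert j S) U), h]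
    with ω h1 h2 h3
  have h4 := congrArg (MvPolynomial.eval fun h : firstChaos X P => (h : Lp ℝ 2 P) ω)
    (X_mul_wickPoly hj U)
  rw [map_mul, MvPolynomial.eval_X, map_add, map_sum] at h4
  rw [h1, h2, mul_comm, h4, add_right_inj]
  refine Finset.sum_congr rfl fun s hs => ?_
  rw [h3 s hs, MvPolynomial.smul_eval, real_inner_comm, firstChaos_inner_def, mul_comm]

end WickChaos

end

theorem proposition7p1 {Ω T : Type*} [MeasurableSpace Ω] {P : Measure Ω} [IsProbabilityMeasure P]
    {X : T → Ω → ℝ} (hX : IsGaussianProcess X P) (hmean : ∀ t, ∫ ω, X t ω ∂P = 0) :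
    (∀ (n : ℕ), 1 ≤ n → ∀ U : Fin (n + 1) → WickChaos.firstChaos X P,
      ∀ᵐ ω ∂P,
        WickChaos.wickProd hX (Finset.univ.erase (Fin.last n)) U ω
            * (U (Fin.last n) : Lp ℝ 2 P) ω
          = WickChaos.wickProd hX Finset.univ U ω
            + ∑ s : Fin n,
                WickChaos.wickProd hX ((Finset.univ.erase (Fin.last n)).erase s.castSucc) U ω
                  * ∫ ω', (U s.castSucc : Lp ℝ 2 P) ω' * (U (Fin.last n) : Lp ℝ 2 P) ω' ∂P) ∧
    (∀ U : Fin 2 → WickChaos.firstChaos X P,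
      ∀ᵐ ω ∂P,
        (U 0 : Lp ℝ 2 P) ω * (U 1 : Lp ℝ 2 P) ω
          = WickChaos.wickProd hX Finset.univ U ω
            + ∫ ω', (U 0 : Lp ℝ 2 P) ω' * (U 1 : Lp ℝ 2 P) ω' ∂P) := by
  constructor
  · intro n _ U
    have h := WickChaos.wickProd_mul hX hmean (Finset.notMem_erase (Fin.last n) Finset.univ) U
    rw [Finset.insert_erase (Finset.mem_univ _)] at h
    filter_upwards [h] with ω h
    rw [h, add_right_inj]
    -- Adding the term of the last index to both sides turns the sum over the erased set into a full
    -- sum over `Fin (n + 1)`.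
    refine add_right_cancel ((Finset.sum_erase_add _ _ (Finset.mem_univ (Fin.last n))).trans ?_)
    rw [Fin.sum_univ_castSucc]
  · intro U
    have h := WickChaos.wickProd_mul hX hmean (S := {0}) (j := 1) (by decide) U
    -- For a single factor the correction is `D 1 = 0`, so `:U₀: = U₀`; the contracted term involves
    -- the empty Wick product `1`.
    have hpoly : WickChaos.wickPoly {0} U = MvPolynomial.X (U 0) := by
      have h0 := WickChaos.wickPoly_insert (Finset.notMem_empty (0 : Fin 2)) U
      simpa [WickChaos.creation_apply] using h0
    have e : (insert 1 {0} : Finset (Fin 2)) = Finset.univ := by decide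
    have h0 := WickChaos.evalLp_ae hX (WickChaos.wickPoly {0} U)
    have h1 := WickChaos.evalLp_ae hX (WickChaos.wickPoly ∅ U)
    rw [e] at h
    filter_upwards [h, h0, h1] with ω h h0 h1
    rw [Finset.sum_singleton, Finset.erase_singleton,
      WickChaos.wickProd_eq_evalLp hX hmean {0} U, WickChaos.wickProd_eq_evalLp hX hmean ∅ U,
      h0, h1, hpoly, WickChaos.wickPoly_empty, map_one, one_mul, MvPolynomial.eval_X] at h
    exact h
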